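/- Let $1\le n\le m$ be integers and $\mathbb K=\mathbb R$ or $\mathbb C$. Equip $\mathbb K^{n\times m}$ with the real inner product $\operatorname{Re}\langle M,N\rangle_F=\operatorname{Re}\operatorname{trace}(N^*M)$ and its norm, the Frobenius norm $\|\cdot\|_F$. Let $\sigma_1(A)\ge\dots\ge\sigma_n(A)\ge 0$ denote the singular values of $A\in\mathbb K^{n\times m}$, let $\mathbb{GL}_{n,m}^{>}$ be the set of matrices $A\in\mathbb K^{n\times m}$ of rank $n$ whose smallest singular value is simple, i.e. $\sigma_{n-1}(A)>\sigma_n(A)$ (no condition when $n=1$), and for $r>0$ let $\mathbb S_r(\mathbb{GL}_{n,m}^{>})=\{A\in\mathbb{GL}_{n,m}^{>} : \|A\|_F=r\}$. A positive function $\alpha$ of class $C^2$ on a Riemannian manifold $(\mathcal M,\langle\cdot,\cdot\rangle)$ is called self-convex if, for every geodesic $\gamma$ of $\mathcal M$ equipped with the condition metric $\langle\cdot,\cdot\rangle_{\kappa,x}=\alpha(x)\langle\cdot,\cdot\rangle_x$, the function $t\mapsto\log\alpha(\gamma(t))$ is convex. Then, for every $r>0$, $\mathbb S_r(\mathbb{GL}_{n,m}^{>})$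 is an embedded submanifold of $\mathbb K^{n\times m}$, the function $\alpha(A)=\sigma_n(A)^{-2}$ is positive and of class $C^2$ on it, and $\alpha$ is self-convex on $\mathbb S_r(\mathbb{GL}_{n,m}^{>})$ equipped with the Riemannian metric induced by $\operatorname{Re}\langle\cdot,\cdot\rangle_F$. -/

import Mathlib

open scoped ContDiff Matrix

/-- The `i`-th partial derivative `∂f/∂z_i` at `z` of a map defined on (part of) `ℝ^d`. -/
noncomputable def partialDeriv {F : Type*} [NormedAddCommGroup F] [NormedSpace ℝ F] {d : ℕ} (i : Fin d)
    (f : EuclideanSpace ℝ (Fin d) → F) (z : EuclideanSpace ℝ (Fin d)) : F :=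
  fderiv ℝ f z (EuclideanSpace.single i 1)

/-- `φ : V → M` is a smooth local parametrization (inverse of a chart) of the subset `M` of `E`:
`V` is open in `ℝ^d`, `φ` is a smooth immersion on `V`, and `φ` is a homeomorphism of `V` onto a
relatively open subset of `M`. -/
structure IsLocalParametrization {E : Type*} [NormedAddCommGroup E] [NormedSpace ℝ E] {d : ℕ}
    (M : Set E) (V : Set (EuclideanSpace ℝ (Fin d))) (φ : EuclideanSpace ℝ (Fin d) → E) :
    Prop where
  isOpen : IsOpen V
  contDiffOn : ContDiffOn ℝ ∞ φ V
  immersion : ∀ z ∈ V, Function.Injective (fderiv ℝ φ z)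
  injOn : Set.InjOn φ V
  isOpenMap : ∀ W ⊆ V, IsOpen W → ∃ U : Set E, IsOpen U ∧ φ '' W = M ∩ U

/-- `M` is a smooth embedded submanifold (without boundary) of `E`. -/
def IsEmbeddedSubmanifold {E : Type*} [NormedAddCommGroup E] [NormedSpace ℝ E]
    (M : Set E) : Prop :=
  ∃ d : ℕ, ∀ x ∈ M, ∃ (V : Set (EuclideanSpace ℝ (Fin d))) (φ : EuclideanSpace ℝ (Fin d) → E),
    IsLocalParametrization M V φ ∧ x ∈ φ '' V

/-- The coefficients `g_{ij}(z) = g_{φ(z)}(∂_i φ(z), ∂_j φ(z))` of the Riemannian metric `g` in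
the parametrization `φ`. -/
noncomputable def metricCoeff {E : Type*} [NormedAddCommGroup E] [NormedSpace ℝ E] {d : ℕ}
    (g : E → E → E → ℝ) (φ : EuclideanSpace ℝ (Fin d) → E) (z : EuclideanSpace ℝ (Fin d)) :
    Matrix (Fin d) (Fin d) ℝ :=
  Matrix.of fun i j => g (φ z) (partialDeriv i φ z) (partialDeriv j φ z)

/-- The Christoffel symbols of the Levi-Civita connection,
`Γ^k_{ij} = 1/2 ∑_l g^{kl} (∂_i g_{jl} + ∂_j g_{il} - ∂_l g_{ij})`. -/
noncomputable def christoffel {d : ℕ} (G : EuclideanSpace ℝ (Fin d) → Matrix (Fin d) (Fin d) ℝ)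
    (z : EuclideanSpace ℝ (Fin d)) (k i j : Fin d) : ℝ :=
  (1 / 2 : ℝ) * ∑ l, (G z)⁻¹ k l *
    (partialDeriv i (fun w => G w j l) z + partialDeriv j (fun w => G w i l) z
      - partialDeriv l (fun w => G w i j) z)

/-- `γ : I → M` is a geodesic of the submanifold `M` of `E` for the Riemannian metric on `M` that
is given at `x` by the restriction of `g x` to the tangent space of `M` at `x`: the curve is `C²`
and in all local coordinates it satisfies the geodesic equation
`c_k'' + ∑_{i,j} Γ^k_{ij}(c) c_i' c_j' = 0`. (The interval `I` may contain its end-points;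
the equation is stated on open pieces of `I`, and extends to the end-points by continuity.) -/
def IsGeodesicOn {E : Type*} [NormedAddCommGroup E] [NormedSpace ℝ E]
    (g : E → E → E → ℝ) (M : Set E) (γ : ℝ → E) (I : Set ℝ) : Prop :=
  ContDiffOn ℝ 2 γ I ∧ Set.MapsTo γ I M ∧
    ∀ (d : ℕ) (V : Set (EuclideanSpace ℝ (Fin d))) (φ : EuclideanSpace ℝ (Fin d) → E),
      IsLocalParametrization M V φ →
      ∀ (J : Set ℝ) (c : ℝ → EuclideanSpace ℝ (Fin d)),
        IsOpen J → J ⊆ I → ContDiffOn ℝ 2 c J → Set.MapsTo c J V → Set.EqOn (φ ∘ c) γ J →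
        ∀ t ∈ J, ∀ k : Fin d,
          deriv (deriv fun s => c s k) t
            + ∑ i, ∑ j, christoffel (metricCoeff g φ) (c t) k i j
                * deriv (fun s => c s i) t * deriv (fun s => c s j) t = 0

/-- The condition metric `⟨u, v⟩_{κ, x} = α(x) ⟨u, v⟩`. -/
noncomputable def conditionMetric {E : Type*} [NormedAddCommGroup E] [InnerProductSpace ℝ E]
    (α : E → ℝ) (x u v : E) : ℝ :=
  α x * inner ℝ u v

/-- `α` is self-convex on the submanifold `M` of the real inner product space `E`: `M` with the
induced metric is a Riemannian manifold, `α` is positive and of class `C²` on `M`, and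
`log (α (γ t))` is convex for every geodesic `γ` of `M` equipped with the condition metric
`α ⟨·, ·⟩`. -/
structure IsSelfConvexOn {E : Type*} [NormedAddCommGroup E] [InnerProductSpace ℝ E]
    (M : Set E) (α : E → ℝ) : Prop where
  isEmbeddedSubmanifold : IsEmbeddedSubmanifold M
  pos : ∀ x ∈ M, 0 < α x
  contDiffOn : ∀ (d : ℕ) (V : Set (EuclideanSpace ℝ (Fin d)))
    (φ : EuclideanSpace ℝ (Fin d) → E), IsLocalParametrization M V φ → ContDiffOn ℝ 2 (α ∘ φ) V
  convex : ∀ (I : Set ℝ) (γ : ℝ → E), I.OrdConnected →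
    IsGeodesicOn (conditionMetric α) M γ I → ConvexOn ℝ I fun t => Real.log (α (γ t))

attribute [local instance] Matrix.frobeniusNormedAddCommGroup Matrix.frobeniusNormedSpace

/-- The real inner product `Re ⟨M, N⟩_F = Re trace (N* M)` on `𝕜^{n × m}`. Its norm is the
Frobenius norm. -/
@[reducible]
noncomputable def frobeniusInnerProductSpace (𝕜 : Type*) [RCLike 𝕜] (n m : ℕ) :
    InnerProductSpace ℝ (Matrix (Fin n) (Fin m) 𝕜) where
  toNormedSpace := Matrix.frobeniusNormedSpace
  inner M N := RCLike.re (Nᴴ * M).trace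
  norm_sq_eq_re_inner M := by
    have h : (∑ i, ∑ j, ‖M i j‖ ^ (2 : ℝ)) = RCLike.re (Mᴴ * M).trace := by
      simp only [Matrix.trace, Matrix.diag, Matrix.mul_apply, Matrix.conjTranspose_apply, map_sum]
      rw [Finset.sum_comm]
      refine Finset.sum_congr rfl fun j _ => Finset.sum_congr rfl fun i _ => ?_
      rw [RCLike.star_def, RCLike.conj_mul]
      norm_cast
    change ‖M‖ ^ 2 = RCLike.re (Mᴴ * M).trace
    rw [Matrix.frobenius_norm_def, ← h, ← Real.rpow_natCast, ← Real.rpow_mul (by positivity)]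
    norm_num
  conj_inner_symm M N := by
    change RCLike.re (Mᴴ * N).trace = RCLike.re (Nᴴ * M).trace
    rw [← RCLike.conj_re, ← RCLike.star_def, ← Matrix.trace_conjTranspose,
      Matrix.conjTranspose_mul, Matrix.conjTranspose_conjTranspose]
  add_left M M' N := by
    simp [Matrix.mul_add, Matrix.trace_add]
  smul_left M N t := by
    simp [Matrix.mul_smul, Matrix.trace_smul, RCLike.smul_re]

attribute [local instance] frobeniusInnerProductSpace

/-- The singular value `σ_k(A)`, `k = 1, 2, …`, in non-increasing order. (Mathlib counts singular
values from `0`.) -/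
noncomputable def sigma {𝕜 : Type*} [RCLike 𝕜] {n m : ℕ} (k : ℕ) (A : Matrix (Fin n) (Fin m) 𝕜) : ℝ :=
  (Matrix.toEuclideanLin A).singularValues (k - 1)

/-- The set `GL_{n,m}^>` of the `n × m` matrices of rank `n` whose smallest singular value `σ_n` is
simple, that is `σ_{n-1} > σ_n` (no condition when `n = 1`). -/
def GLgt (𝕜 : Type*) [RCLike 𝕜] (n m : ℕ) : Set (Matrix (Fin n) (Fin m) 𝕜) :=
  {A | A.rank = n ∧ (2 ≤ n → sigma n A < sigma (n - 1) A)}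

/-! ### Variational inequalities for singular values. -/

section SingularValues

open Module

variable {𝕜 : Type*} [RCLike 𝕜]
  {E : Type*} [NormedAddCommGroup E] [InnerProductSpace 𝕜 E]
  {F : Type*} [NormedAddCommGroup F] [InnerProductSpace 𝕜 F]

/-! Let `v` be a unit left singular vector of `A` for `σ_n`. Then `P B = v v* B` is an orthogonal
projection of the matrix space, and `σ_n(B) ≤ ‖B* v‖ = ‖P B‖` for every `B`, with equality at `A`
(`exists_isSymmetricProjection_sigma`). So `σ_n²` is touched from above at `A` by the quadratic form
`‖P B‖²`: along a curve through `A` the first derivatives agree, and the second derivative of `σ_n²`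
is at most that of the form.

The geodesic equation sees the conformal factor only through its value and gradient, which at `A`
are those of `‖P B‖⁻²`. For a geodesic `x(t)` put `p = ‖P x‖²` and `a = ⟨P x, x'⟩`. The equation
(`IsGeodesicOn.inner_deriv_deriv`) gives `⟨P x, x''⟩ = 2a²/p - ‖x'‖²`; the terms containing the
radius cancel. Hence `p'' p = 4a² - 2p(‖x'‖² - ‖P x'‖²) ≤ 4a² = p'²`. By the comparison `σ_n²`
satisfies the same inequality, which says that `log σ_n⁻²` is convex
(`isSelfConvexOn_sphere_inter`).

Two inputs remain. `σ_n²` is smooth because it is a simple root of the characteristic polynomial of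
`B* B` (`contDiffAt_sq_sigma`); Weyl's inequality supplies the continuity needed there and for
openness of the domain. The geodesic equation is read in the chart that is a graph over the tangent
hyperplane at the current point, where the metric agrees to first order with a multiple of the flat
one. -/

theorem OrthonormalBasis.repr_eq_zero_of_mem_span {ι : Type*} [Fintype ι]
    (b : OrthonormalBasis ι 𝕜 E) {s : Set ι} {x : E} (hx : x ∈ Submodule.span 𝕜 (b '' s))
    {i : ι} (hi : i ∉ s) : b.repr x i = 0 := by
  classical
  induction hx using Submodule.span_induction with
  | mem x h =>
    obtain ⟨j, hj, rfl⟩ := h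
    have : i ≠ j := fun h => hi (h ▸ hj)
    simp [this]
  | zero => simp
  | add x y _ _ hx hy => simp [hx, hy]
  | smul a x _ hx => simp [hx]

theorem OrthonormalBasis.finrank_span_image {ι : Type*} [Fintype ι]
    (b : OrthonormalBasis ι 𝕜 E) (s : Finset ι) :
    finrank 𝕜 (Submodule.span 𝕜 (b '' s)) = s.card := by
  have h := finrank_span_eq_card (R := 𝕜) (b := fun i : s => b i)
    (b.orthonormal.linearIndependent.comp _ Subtype.val_injective)
  rw [Fintype.card_coe] at h
  rw [← h, Set.image_eq_range]
  rfl

namespace LinearMap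

variable [FiniteDimensional 𝕜 E] [FiniteDimensional 𝕜 F] (T : E →ₗ[𝕜] F)

theorem sq_norm_eq_sum_eigenvalues_adjoint_comp_self {N : ℕ} (hN : finrank 𝕜 E = N) (x : E) :
    ‖T x‖ ^ 2 = ∑ i : Fin N, T.singularValues i ^ 2 *
      ‖(T.isSymmetric_adjoint_comp_self.eigenvectorBasis hN).repr x i‖ ^ 2 := by
  set hT := T.isSymmetric_adjoint_comp_self
  set b := hT.eigenvectorBasis hN
  have h1 : ‖T x‖ ^ 2 = RCLike.re (inner 𝕜 x ((adjoint T ∘ₗ T) x)) := by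
    rw [LinearMap.comp_apply, LinearMap.adjoint_inner_right, inner_self_eq_norm_sq]
  rw [h1, ← b.sum_inner_mul_inner, map_sum]
  refine Finset.sum_congr rfl fun i _ => ?_
  rw [← b.repr_apply_apply, hT.eigenvectorBasis_apply_self_apply hN x i,
    T.sq_singularValues_fin hN, ← inner_conj_symm, ← b.repr_apply_apply, mul_left_comm,
    RCLike.conj_mul]
  norm_cast

/-- One half of Courant–Fischer: the span of the right singular vectors with indices `0, …, k`. The
next lemma uses those with indices `≥ k`. -/
theorem exists_finrank_eq_forall_singularValues_mul_norm_le {k : ℕ} (hk : k < finrank 𝕜 E) :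
    ∃ W : Submodule 𝕜 E, finrank 𝕜 W = k + 1 ∧ ∀ x ∈ W, T.singularValues k * ‖x‖ ≤ ‖T x‖ := by
  set b := T.isSymmetric_adjoint_comp_self.eigenvectorBasis rfl
  let s : Finset (Fin (finrank 𝕜 E)) := Finset.Iic ⟨k, hk⟩
  refine ⟨Submodule.span 𝕜 (b '' s), ?_, fun x hx => ?_⟩
  · rw [b.finrank_span_image]; simp [s]
  · refine (sq_le_sq₀ (by have := T.singularValues_nonneg k; positivity) (norm_nonneg _)).1 ?_
    rw [mul_pow, T.sq_norm_eq_sum_eigenvalues_adjoint_comp_self rfl,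
      ← b.repr.norm_map x, EuclideanSpace.norm_sq_eq, Finset.mul_sum]
    refine Finset.sum_le_sum fun i _ => ?_
    by_cases hi : i ∈ s
    · have : (i : ℕ) ≤ k := Fin.le_def.1 (by simpa [s] using hi)
      have := T.singularValues_antitone this
      have := T.singularValues_nonneg k
      gcongr
    · have := b.repr_eq_zero_of_mem_span hx (i := i) (by simpa using hi)
      simp [b, this]

theorem exists_finrank_eq_forall_norm_le_singularValues_mul {k : ℕ} (hk : k < finrank 𝕜 E) :
    ∃ W : Submodule 𝕜 E, finrank 𝕜 W = finrank 𝕜 E - k ∧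
      ∀ x ∈ W, ‖T x‖ ≤ T.singularValues k * ‖x‖ := by
  set b := T.isSymmetric_adjoint_comp_self.eigenvectorBasis rfl
  let s : Finset (Fin (finrank 𝕜 E)) := Finset.Ici ⟨k, hk⟩
  refine ⟨Submodule.span 𝕜 (b '' s), ?_, fun x hx => ?_⟩
  · rw [b.finrank_span_image]; simp [s]
  · refine (sq_le_sq₀ (norm_nonneg _) (by have := T.singularValues_nonneg k; positivity)).1 ?_
    rw [mul_pow, T.sq_norm_eq_sum_eigenvalues_adjoint_comp_self rfl,
      ← b.repr.norm_map x, EuclideanSpace.norm_sq_eq, Finset.mul_sum]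
    refine Finset.sum_le_sum fun i _ => ?_
    by_cases hi : i ∈ s
    · have : k ≤ (i : ℕ) := Fin.le_def.1 (by simpa [s] using hi)
      have := T.singularValues_antitone this
      have := T.singularValues_nonneg i
      gcongr
    · have := b.repr_eq_zero_of_mem_span hx (i := i) (by simpa using hi)
      simp [b, this]

/-- Weyl's perturbation inequality for singular values. -/
theorem singularValues_le_add (S : E →ₗ[𝕜] F) {c : ℝ} (hc : 0 ≤ c)
    (h : ∀ x, ‖T x - S x‖ ≤ c * ‖x‖) (k : ℕ) :
    T.singularValues k ≤ S.singularValues k + c := by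
  rcases le_or_gt (finrank 𝕜 E) k with hk | hk
  · rw [T.singularValues_of_finrank_le hk, S.singularValues_of_finrank_le hk]; linarith
  obtain ⟨V, hV, hVT⟩ := T.exists_finrank_eq_forall_singularValues_mul_norm_le hk
  obtain ⟨W, hW, hWS⟩ := S.exists_finrank_eq_forall_norm_le_singularValues_mul hk
  -- The dimensions `k + 1` and `finrank E - k` add up to one more than that of `E`.
  have hne : V ⊓ W ≠ ⊥ := by
    intro hbot
    have h1 := Submodule.finrank_sup_add_finrank_inf_eq V W
    have h2 := (V ⊔ W).finrank_le
    rw [hbot, finrank_bot] at h1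
    omega
  obtain ⟨x, ⟨hxV, hxW⟩, hx0⟩ := Submodule.exists_mem_ne_zero_of_ne_bot hne
  have hx : 0 < ‖x‖ := norm_pos_iff.2 hx0
  refine le_of_mul_le_mul_right ?_ hx
  calc T.singularValues k * ‖x‖ ≤ ‖T x‖ := hVT x hxV
    _ = ‖S x + (T x - S x)‖ := by rw [add_sub_cancel]
    _ ≤ S.singularValues k * ‖x‖ + c * ‖x‖ :=
      (norm_add_le _ _).trans (add_le_add (hWS x hxW) (h x))
    _ = (S.singularValues k + c) * ‖x‖ := by ring

/-- If `σ_k > 0`, then `T` maps the (k+1)-dimensional Courant–Fischer subspace isomorphically onto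
`F`. Writing `v = T x` there, `‖v‖² = ⟨T* v, x⟩ ≤ ‖T* v‖ ‖x‖` and `σ_k ‖x‖ ≤ ‖v‖`. -/
theorem singularValues_mul_norm_le_norm_adjoint {k : ℕ} (hk : finrank 𝕜 F = k + 1) (v : F) :
    T.singularValues k * ‖v‖ ≤ ‖adjoint T v‖ := by
  rcases (T.singularValues_nonneg k).eq_or_lt with h0 | h0
  · rw [← h0, zero_mul]; exact norm_nonneg _
  have hkE : k < finrank 𝕜 E := by
    by_contra! hk'
    exact h0.ne' (T.singularValues_of_finrank_le hk')
  obtain ⟨W, hW, hWT⟩ := T.exists_finrank_eq_forall_singularValues_mul_norm_le hkE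
  have hinj : Function.Injective (T.domRestrict W) := by
    refine (injective_iff_map_eq_zero _).2 fun x hx => ?_
    have h1 := hWT x x.2
    rw [LinearMap.domRestrict_apply] at hx
    rw [hx, norm_zero] at h1
    have : ‖(x : E)‖ ≤ 0 := by nlinarith
    exact Subtype.ext (norm_le_zero_iff.1 this)
  obtain ⟨x, hx⟩ := (injective_iff_surjective_of_finrank_eq_finrank (hW.trans hk.symm)).1 hinj v
  rw [LinearMap.domRestrict_apply] at hx
  have h1 := hWT x x.2
  rw [hx] at h1
  have h2 : ‖v‖ ^ 2 ≤ ‖adjoint T v‖ * ‖(x : E)‖ := by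
    rw [← inner_self_eq_norm_sq (𝕜 := 𝕜)]
    nth_rw 2 [← hx]
    rw [← LinearMap.adjoint_inner_left]
    exact re_inner_le_norm _ _
  have h3 := norm_nonneg v
  have h4 := norm_nonneg (x : E)
  rcases h3.eq_or_lt with h5 | h5
  · rw [← h5, mul_zero]; exact norm_nonneg _
  refine le_of_mul_le_mul_right ?_ h5
  calc T.singularValues k * ‖v‖ * ‖v‖ = T.singularValues k * ‖v‖ ^ 2 := by ring
    _ ≤ T.singularValues k * (‖adjoint T v‖ * ‖(x : E)‖) := by gcongr
    _ = ‖adjoint T v‖ * (T.singularValues k * ‖(x : E)‖) := by ring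
    _ ≤ ‖adjoint T v‖ * ‖v‖ := by gcongr

/-- The left singular vector is `σ_k⁻¹ T b_k`, with `b_k` a right singular vector. -/
theorem exists_norm_eq_one_norm_adjoint_eq_singularValues {k : ℕ}
    (h0 : 0 < T.singularValues k) :
    ∃ v : F, ‖v‖ = 1 ∧ ‖adjoint T v‖ = T.singularValues k := by
  have hk : k < finrank 𝕜 E := by
    by_contra! hk'
    exact h0.ne' (T.singularValues_of_finrank_le hk')
  set hT := T.isSymmetric_adjoint_comp_self
  set b := hT.eigenvectorBasis rfl
  let i : Fin (finrank 𝕜 E) := ⟨k, hk⟩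
  have h1 : adjoint T (T (b i)) = ((T.singularValues k ^ 2 : ℝ) : 𝕜) • b i := by
    rw [T.sq_singularValues_of_lt rfl hk]
    exact hT.apply_eigenvectorBasis rfl i
  have h2 : ‖T (b i)‖ = T.singularValues k := by
    refine (pow_left_inj₀ (norm_nonneg _) h0.le two_ne_zero).1 ?_
    rw [← inner_self_eq_norm_sq (𝕜 := 𝕜), ← LinearMap.adjoint_inner_left, h1, inner_smul_left,
      inner_self_eq_norm_sq_to_K, b.orthonormal.1 i]
    rw [RCLike.conj_ofReal, RCLike.ofReal_one, one_pow, mul_one, RCLike.ofReal_re]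
  refine ⟨((T.singularValues k)⁻¹ : 𝕜) • T (b i), ?_, ?_⟩
  · rw [norm_smul, h2, norm_inv, RCLike.norm_ofReal, abs_of_pos h0, inv_mul_cancel₀ h0.ne']
  · rw [map_smul, h1, norm_smul, norm_smul, b.orthonormal.1 i, norm_inv, RCLike.norm_ofReal,
      RCLike.norm_ofReal, abs_of_pos h0, abs_of_pos (by positivity)]
    field_simp

theorem eval_charpoly_adjoint_comp_self {N : ℕ} (hN : finrank 𝕜 E = N) (t : ℝ) :
    (adjoint T ∘ₗ T).charpoly.eval (t : 𝕜) =
      ((∏ i : Fin N, (t - T.singularValues i ^ 2) : ℝ) : 𝕜) := by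
  rw [T.isSymmetric_adjoint_comp_self.charpoly_eq hN, Polynomial.eval_prod]
  simp [T.sq_singularValues_fin hN, -map_sub, ← RCLike.ofReal_sub]

end LinearMap

end SingularValues

/-! ### The smallest singular value: openness, smoothness and the touching projection. -/

section FrobeniusMatrices

open Module Filter Topology

variable {𝕜 : Type*} [RCLike 𝕜] {n m : ℕ}

theorem ContinuousLinearMap.lipschitzWith_singularValues
    {E : Type*} [NormedAddCommGroup E] [InnerProductSpace 𝕜 E] [FiniteDimensional 𝕜 E]
    {F : Type*} [NormedAddCommGroup F] [InnerProductSpace 𝕜 F] [FiniteDimensional 𝕜 F] (k : ℕ) :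
    LipschitzWith 1 fun T : E →L[𝕜] F => T.toLinearMap.singularValues k := by
  refine LipschitzWith.of_le_add fun T S => ?_
  rw [dist_eq_norm]
  exact LinearMap.singularValues_le_add _ _ (norm_nonneg _) (fun x => (T - S).le_opNorm x) _

theorem continuous_matrix_sigma (k : ℕ) :
    Continuous (sigma k : Matrix (Fin n) (Fin m) 𝕜 → ℝ) := by
  let ℓ : Matrix (Fin n) (Fin m) 𝕜 →ₗ[ℝ] EuclideanSpace 𝕜 (Fin m) →L[𝕜] EuclideanSpace 𝕜 (Fin n) :=
    { toFun := fun A => LinearMap.toContinuousLinearMap (Matrix.toEuclideanLin A)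
      map_add' := fun A B => by rw [map_add, map_add]
      map_smul' := fun t A => by ext; simp [Matrix.toLpLin_apply, Matrix.smul_mulVec] }
  have hℓ : Continuous ℓ := ℓ.continuous_of_finiteDimensional
  have h := (ContinuousLinearMap.lipschitzWith_singularValues (k - 1)).continuous.comp hℓ
  refine h.congr fun A => ?_
  change (LinearMap.toContinuousLinearMap (Matrix.toEuclideanLin A)).toLinearMap.singularValues _ = _
  rw [LinearMap.coe_toContinuousLinearMap, sigma]

theorem sigma_pos_iff_rank_eq (hn : 1 ≤ n) (A : Matrix (Fin n) (Fin m) 𝕜) :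
    0 < sigma n A ↔ A.rank = n := by
  have h := Matrix.rank_eq_finrank_range_toLin A (PiLp.basisFun 2 𝕜 (Fin n))
    (PiLp.basisFun 2 𝕜 (Fin m))
  change A.rank = finrank 𝕜 (Matrix.toEuclideanLin A).range at h
  rw [sigma, LinearMap.singularValues_pos_iff_lt_finrank_range, ← h]
  have := A.rank_le_height
  omega

theorem isOpen_GLgt (hn : 1 ≤ n) : IsOpen (GLgt 𝕜 n m) := by
  have : GLgt 𝕜 n m = {A | 0 < sigma n A} ∩ {A | 2 ≤ n → sigma n A < sigma (n - 1) A} := by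
    ext A
    simp only [GLgt, Set.mem_inter_iff, Set.mem_ofPred_eq, sigma_pos_iff_rank_eq hn]
  rw [this]
  refine (isOpen_lt continuous_const (continuous_matrix_sigma n)).inter ?_
  by_cases h : 2 ≤ n
  · simpa [h] using isOpen_lt (continuous_matrix_sigma n) (continuous_matrix_sigma (n - 1))
  · simp [h]

/-- Indices are 0-based: those below `n - 1` are excluded by the gap, those above it because the
singular value vanishes while `σ_n > 0`. This makes `σ_n²` a simple eigenvalue of the m × m matrix
`A* A`, even when `m > n`. -/
theorem singularValues_ne_of_mem_GLgt (hn : 1 ≤ n) {A : Matrix (Fin n) (Fin m) 𝕜}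
    (hA : A ∈ GLgt 𝕜 n m) {j : ℕ} (hj : j ≠ n - 1) :
    (Matrix.toEuclideanLin A).singularValues j ≠ sigma n A := by
  have hpos := (sigma_pos_iff_rank_eq hn A).2 hA.1
  rcases lt_or_gt_of_ne hj with h | h
  · have h1 : j ≤ n - 1 - 1 := by omega
    exact ((hA.2 (by omega)).trans_le ((Matrix.toEuclideanLin A).singularValues_antitone h1)).ne'
  · refine ne_of_lt (lt_of_le_of_lt (le_of_eq ?_) hpos)
    rw [LinearMap.singularValues_eq_zero_iff_le_finrank_range]
    have := (Matrix.toEuclideanLin A).range.finrank_le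
    rw [finrank_euclideanSpace_fin] at this
    omega

/-- The real part of the characteristic polynomial of `Bᴴ B` at `t`. -/
noncomputable def reCharpolyGram (p : Matrix (Fin n) (Fin m) 𝕜 × ℝ) : ℝ :=
  RCLike.re ((p.1ᴴ * p.1).charpoly.eval (p.2 : 𝕜))

theorem reCharpolyGram_eq_prod (B : Matrix (Fin n) (Fin m) 𝕜) (t : ℝ) :
    reCharpolyGram (B, t) =
      ∏ i : Fin m, (t - (Matrix.toEuclideanLin B).singularValues i ^ 2) := by
  have h : (Bᴴ * B).charpoly = (LinearMap.adjoint (Matrix.toEuclideanLin B) ∘ₗ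
      Matrix.toEuclideanLin B).charpoly := by
    rw [← Matrix.toEuclideanLin_conjTranspose_eq_adjoint,
      ← Matrix.charpoly_toLin (Bᴴ * B) (PiLp.basisFun 2 𝕜 (Fin m)),
      Matrix.toLin_mul _ (PiLp.basisFun 2 𝕜 (Fin n))]
    rfl
  have h' := LinearMap.eval_charpoly_adjoint_comp_self (Matrix.toEuclideanLin B)
    (finrank_euclideanSpace_fin (𝕜 := 𝕜) (n := m)) t
  rw [reCharpolyGram, h, h', RCLike.ofReal_re]

theorem contDiff_reCharpolyGram :
    ContDiff ℝ ∞ (reCharpolyGram : Matrix (Fin n) (Fin m) 𝕜 × ℝ → ℝ) := by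
  have hentry (i : Fin n) (j : Fin m) :
      ContDiff ℝ ∞ fun p : Matrix (Fin n) (Fin m) 𝕜 × ℝ => p.1 i j := by
    let e : Matrix (Fin n) (Fin m) 𝕜 →ₗ[ℝ] 𝕜 := Matrix.entryLinearMap ℝ 𝕜 i j
    exact e.toContinuousLinearMap.contDiff.comp contDiff_fst
  have hstar (i : Fin n) (j : Fin m) :
      ContDiff ℝ ∞ fun p : Matrix (Fin n) (Fin m) 𝕜 × ℝ => star (p.1 i j) :=
    (RCLike.conjCLE (K := 𝕜)).contDiff.comp (hentry i j)
  have hreal : ContDiff ℝ ∞ fun p : Matrix (Fin n) (Fin m) 𝕜 × ℝ => (p.2 : 𝕜) :=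
    (RCLike.ofRealCLM (K := 𝕜)).contDiff.comp contDiff_snd
  have hre : ContDiff ℝ ∞ (RCLike.re : 𝕜 → ℝ) := (RCLike.reCLM (K := 𝕜)).contDiff
  unfold reCharpolyGram
  refine hre.comp ?_
  simp only [Matrix.eval_charpoly, Matrix.det_apply, Matrix.sub_apply, Matrix.scalar_apply,
    Matrix.mul_apply, Matrix.conjTranspose_apply]
  refine ContDiff.sum fun g _ => ContDiff.const_smul _ (contDiff_prod fun i _ => ?_)
  refine ContDiff.sub ?_ (ContDiff.sum fun k _ => (hstar k _).mul (hentry k _))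
  by_cases h : g i = i
  · simpa [h] using hreal
  · simpa [h] using contDiff_const

/-- Implicit function theorem for `det(t - B* B) = 0` at the simple root `t = σ_n(A)²`. -/
theorem contDiffAt_sq_sigma (hn : 1 ≤ n) (hnm : n ≤ m) {A : Matrix (Fin n) (Fin m) 𝕜}
    (hA : A ∈ GLgt 𝕜 n m) :
    ContDiffAt ℝ ∞ (fun B : Matrix (Fin n) (Fin m) 𝕜 => sigma n B ^ 2) A := by
  let i₀ : Fin m := ⟨n - 1, by omega⟩
  let s : Matrix (Fin n) (Fin m) 𝕜 → ℝ := fun B => sigma n B ^ 2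
  let q : ℝ := ∏ i ∈ Finset.univ.erase i₀,
    (s A - (Matrix.toEuclideanLin A).singularValues i ^ 2)
  have hq : q ≠ 0 := by
    refine Finset.prod_ne_zero_iff.2 fun i hi => sub_ne_zero.2 fun h => ?_
    have hi' : (i : ℕ) ≠ n - 1 := fun h => (Finset.mem_erase.1 hi).1 (Fin.ext h)
    exact singularValues_ne_of_mem_GLgt hn hA hi' ((pow_left_inj₀
      (LinearMap.singularValues_nonneg _ _) (LinearMap.singularValues_nonneg _ _) two_ne_zero).1 h.symm)
  have hzero (B : Matrix (Fin n) (Fin m) 𝕜) : reCharpolyGram (B, s B) = 0 := by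
    rw [reCharpolyGram_eq_prod]
    exact Finset.prod_eq_zero (Finset.mem_univ i₀) (sub_self _)
  have cdf : ContDiffAt ℝ ∞ reCharpolyGram (A, s A) := contDiff_reCharpolyGram.contDiffAt
  have hfd : HasFDerivAt reCharpolyGram (fderiv ℝ reCharpolyGram (A, s A)) (A, s A) :=
    (cdf.differentiableAt (by simp)).hasFDerivAt
  -- Differentiating the product at its root leaves only the term in which the vanishing factor is
  -- removed.
  have hder : HasDerivAt (fun t => reCharpolyGram (A, t)) q (s A) := by
    have h1 : DifferentiableAt ℝ (fun t => ∏ i ∈ Finset.univ.erase i₀,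
        (t - (Matrix.toEuclideanLin A).singularValues i ^ 2)) (s A) := by fun_prop
    have h2 := ((hasDerivAt_id (s A)).sub_const (s A)).mul h1.hasDerivAt
    simp only [id, sub_self, zero_mul, add_zero, one_mul] at h2
    refine h2.congr_of_eventuallyEq (Eventually.of_forall fun t => ?_)
    exact (reCharpolyGram_eq_prod A t).trans (Finset.mul_prod_erase _ _ (Finset.mem_univ i₀)).symm
  have hone : (fderiv ℝ reCharpolyGram (A, s A) ∘L .inr ℝ _ ℝ) 1 = q := by
    have h := hfd.comp_hasDerivAt (s A) ((hasDerivAt_const (s A) A).prodMk (hasDerivAt_id (s A)))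
    exact (hder.unique h).symm
  have hinv : (fderiv ℝ reCharpolyGram (A, s A) ∘L .inr ℝ _ ℝ).IsInvertible := by
    refine ⟨ContinuousLinearEquiv.unitsEquivAut ℝ (Units.mk0 q hq), ?_⟩
    ext
    rw [hone]
    simp
  have hev := cdf.eventually_apply_eq_iff_implicitFunction (by simp) hinv
  -- Uniqueness of the implicit function holds only near `(A, s A)`; continuity keeps `(B, s B)`
  -- there for `B` near `A`.
  have hs : Continuous s := (continuous_matrix_sigma n).pow 2
  have ht : Tendsto (fun B => (B, s B)) (𝓝 A) (𝓝 (A, s A)) :=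
    (continuous_id.prodMk hs).continuousAt
  refine (cdf.contDiffAt_implicitFunction (by simp) hinv).congr_of_eventuallyEq ?_
  filter_upwards [ht.eventually hev] with B hB
  exact (hB.1 ((hzero B).trans (hzero A).symm)).symm

/-- `P` is left multiplication by `v v*`, for a unit left singular vector `v` of `A` belonging to
`σ_n(A)`. -/
theorem exists_isSymmetricProjection_sigma (hn : 1 ≤ n) {A : Matrix (Fin n) (Fin m) 𝕜}
    (hA : A ∈ GLgt 𝕜 n m) :
    ∃ P : Matrix (Fin n) (Fin m) 𝕜 →ₗ[ℝ] Matrix (Fin n) (Fin m) 𝕜,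
      P.IsSymmetricProjection ∧ (∀ B, sigma n B ≤ ‖P B‖) ∧ sigma n A = ‖P A‖ := by
  obtain ⟨v, hv, hvA⟩ := LinearMap.exists_norm_eq_one_norm_adjoint_eq_singularValues
    (Matrix.toEuclideanLin A) ((sigma_pos_iff_rank_eq hn A).2 hA.1)
  let w : Fin n → 𝕜 := v
  let Q : Matrix (Fin n) (Fin n) 𝕜 := Matrix.vecMulVec w (star w)
  have hw : star w ⬝ᵥ w = 1 := by
    have := inner_self_eq_norm_sq_to_K (𝕜 := 𝕜) v
    rw [hv, EuclideanSpace.inner_eq_star_dotProduct, dotProduct_comm] at this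
    simpa using this
  have hQ : Qᴴ = Q := by
    simp [Q, Matrix.conjTranspose_vecMulVec]
  have hQQ : Q * Q = Q := by
    simp [Q, Matrix.vecMulVec_mul_vecMulVec, hw]
  let P : Matrix (Fin n) (Fin m) 𝕜 →ₗ[ℝ] Matrix (Fin n) (Fin m) 𝕜 :=
    { toFun := fun B => Q * B
      map_add' := fun B C => Matrix.mul_add Q B C
      map_smul' := fun t B => Matrix.mul_smul Q t B }
  have hP (B : Matrix (Fin n) (Fin m) 𝕜) :
      ‖P B‖ = ‖LinearMap.adjoint (Matrix.toEuclideanLin B) v‖ := by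
    refine (pow_left_inj₀ (norm_nonneg _) (norm_nonneg _) two_ne_zero).1 ?_
    have h1 : ‖P B‖ ^ 2 = RCLike.re ((Q * B)ᴴ * (Q * B)).trace :=
      InnerProductSpace.norm_sq_eq_re_inner (𝕜 := ℝ) (P B)
    have h2 : (Q * B)ᴴ * (Q * B) = Matrix.vecMulVec (Bᴴ *ᵥ w) (star (Bᴴ *ᵥ w)) := by
      rw [Matrix.conjTranspose_mul, hQ, Matrix.mul_assoc, ← Matrix.mul_assoc Q, hQQ,
        ← Matrix.mul_assoc, Matrix.mul_vecMulVec, Matrix.vecMulVec_mul, Matrix.star_mulVec,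
        Matrix.conjTranspose_conjTranspose]
    rw [h1, h2, Matrix.trace_vecMulVec, ← Matrix.toEuclideanLin_conjTranspose_eq_adjoint,
      ← inner_self_eq_norm_sq (𝕜 := 𝕜), EuclideanSpace.inner_eq_star_dotProduct]
    rfl
  refine ⟨P, ⟨?_, ?_⟩, fun B => ?_, ?_⟩
  · ext1 B
    change Q * (Q * B) = Q * B
    rw [← Matrix.mul_assoc, hQQ]
  · intro B C
    change RCLike.re (Cᴴ * (Q * B)).trace = RCLike.re ((Q * C)ᴴ * B).trace
    rw [Matrix.conjTranspose_mul, hQ, Matrix.mul_assoc]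
  · have hk : finrank 𝕜 (EuclideanSpace 𝕜 (Fin n)) = n - 1 + 1 := by
      rw [finrank_euclideanSpace_fin]; omega
    rw [hP, ← mul_one (sigma n B), ← hv]
    exact LinearMap.singularValues_mul_norm_le_norm_adjoint _ hk v
  · rw [hP, hvA, sigma]

end FrobeniusMatrices

/-! ### Hemisphere charts and Christoffel symbols of a conformal metric at the pole. -/

section Sphere

open Module Filter Topology

variable {E : Type*} [NormedAddCommGroup E] [InnerProductSpace ℝ E] {d : ℕ}

/-- Only the 1-jet of the metric at one point enters, so the metric need not be conformally flat
around `z`. -/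
theorem christoffel_contraction_of_conformal
    {G : EuclideanSpace ℝ (Fin d) → Matrix (Fin d) (Fin d) ℝ} {z : EuclideanSpace ℝ (Fin d)}
    {β : ℝ} (hG : G z = β • 1) (a : Fin d → ℝ)
    (ha : ∀ l i j, partialDeriv l (fun w => G w i j) z = if i = j then a l else 0)
    (v : Fin d → ℝ) (k : Fin d) :
    ∑ i, ∑ j, christoffel G z k i j * v i * v j =
      β⁻¹ * ((∑ i, a i * v i) * v k - a k * (∑ i, v i ^ 2) / 2) := by
  have hΓ (i j : Fin d) : christoffel G z k i j = β⁻¹ / 2 *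
      ((if j = k then a i else 0) + (if i = k then a j else 0) - if i = j then a k else 0) := by
    have hinv : (G z)⁻¹ = β⁻¹ • 1 := by
      rw [hG]
      -- For `β = 0` both inverses are zero by convention.
      rcases eq_or_ne β 0 with rfl | hβ
      · simp
      · refine Matrix.inv_eq_left_inv ?_
        simp [smul_smul, hβ]
    rw [christoffel, hinv]
    simp only [ha, Matrix.smul_apply, Matrix.one_apply, smul_eq_mul, mul_ite, mul_one, mul_zero,
      ite_mul, zero_mul, Finset.sum_ite_eq, Finset.mem_univ, if_true]
    ring
  have h1 : ∑ i, ∑ j, (if j = k then a i else 0) * v i * v j = (∑ i, a i * v i) * v k := by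
    simp [ite_mul, Finset.sum_mul]
  have h2 : ∑ i, ∑ j, (if i = k then a j else 0) * v i * v j = (∑ i, a i * v i) * v k := by
    rw [Finset.sum_comm]
    simp only [ite_mul, zero_mul, Finset.sum_ite_eq', Finset.mem_univ, if_true, Finset.sum_mul]
    exact Finset.sum_congr rfl fun i _ => by ring
  have h3 : ∑ i, ∑ j, (if i = j then a k else 0) * v i * v j = a k * ∑ i, v i ^ 2 := by
    simp only [ite_mul, zero_mul, Finset.sum_ite_eq, Finset.mem_univ, if_true, Finset.mul_sum]
    exact Finset.sum_congr rfl fun i _ => by ring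
  calc ∑ i, ∑ j, christoffel G z k i j * v i * v j
      = β⁻¹ / 2 * (∑ i, ∑ j, (if j = k then a i else 0) * v i * v j
        + ∑ i, ∑ j, (if i = k then a j else 0) * v i * v j
        - ∑ i, ∑ j, (if i = j then a k else 0) * v i * v j) := by
        simp only [hΓ, ← Finset.sum_add_distrib, ← Finset.sum_sub_distrib, Finset.mul_sum]
        exact Finset.sum_congr rfl fun i _ => Finset.sum_congr rfl fun j _ => by ring
    _ = _ := by rw [h1, h2, h3]; ring

/-- A linear isometry of `ℝ^d` onto the orthogonal complement of `x`. -/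
structure IsOrthogonalFrame (x : E) (L : EuclideanSpace ℝ (Fin d) →ₗᵢ[ℝ] E) : Prop where
  inner_eq_zero : ∀ z, inner ℝ x (L z) = 0
  exists_eq : ∀ y, inner ℝ x y = 0 → ∃ z, L z = y

theorem exists_isOrthogonalFrame (hE : finrank ℝ E = d + 1) {x : E} (hx : x ≠ 0) :
    ∃ L : EuclideanSpace ℝ (Fin d) →ₗᵢ[ℝ] E, IsOrthogonalFrame x L := by
  have : Fact (finrank ℝ E = d + 1) := ⟨hE⟩
  let b := OrthonormalBasis.fromOrthogonalSpanSingleton (𝕜 := ℝ) d hx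
  refine ⟨(Submodule.subtypeₗᵢ _).comp b.repr.symm.toLinearIsometry, fun z => ?_, fun y hy => ?_⟩
  · exact Submodule.mem_orthogonal_singleton_iff_inner_right.1 (b.repr.symm z).2
  · refine ⟨b.repr ⟨y, Submodule.mem_orthogonal_singleton_iff_inner_right.2 hy⟩, ?_⟩
    simp

/-- The hemisphere centred at `x` as the graph over the orthogonal complement of `x`. -/
noncomputable def hemisphereParam (r : ℝ) (x : E) (L : EuclideanSpace ℝ (Fin d) →ₗᵢ[ℝ] E)
    (z : EuclideanSpace ℝ (Fin d)) : E :=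
  (√(r ^ 2 - ‖z‖ ^ 2) / r) • x + L z

variable [CompleteSpace E] {r : ℝ} {x : E} {L : EuclideanSpace ℝ (Fin d) →ₗᵢ[ℝ] E}

/-- The adjoint of a linear isometry of `ℝ^d`. -/
noncomputable def frameAdjoint (L : EuclideanSpace ℝ (Fin d) →ₗᵢ[ℝ] E) :
    E →L[ℝ] EuclideanSpace ℝ (Fin d) :=
  ContinuousLinearMap.adjoint L.toContinuousLinearMap

theorem inner_frameAdjoint_left (y : E) (z : EuclideanSpace ℝ (Fin d)) :
    inner ℝ (frameAdjoint L y) z = inner ℝ y (L z) :=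
  ContinuousLinearMap.adjoint_inner_left _ _ _

theorem frameAdjoint_apply_self (z : EuclideanSpace ℝ (Fin d)) : frameAdjoint L (L z) = z :=
  ext_inner_right ℝ fun w => by rw [inner_frameAdjoint_left, L.inner_map_map]

namespace IsOrthogonalFrame

variable (hL : IsOrthogonalFrame x L)
include hL

theorem frameAdjoint_eq_zero : frameAdjoint L x = 0 :=
  ext_inner_right ℝ fun w => by rw [inner_frameAdjoint_left, hL.inner_eq_zero, inner_zero_left]

omit [CompleteSpace E] in
theorem inner_left_eq_zero (z : EuclideanSpace ℝ (Fin d)) : inner ℝ (L z) x = 0 := by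
  rw [real_inner_comm, hL.inner_eq_zero]

theorem smul_add_frameAdjoint (hr : 0 < r) (hx : ‖x‖ = r) (y : E) :
    (inner ℝ x y / r ^ 2) • x + L (frameAdjoint L y) = y := by
  obtain ⟨z, hz⟩ := hL.exists_eq (y - (inner ℝ x y / r ^ 2) • x) (by
    rw [inner_sub_right, inner_smul_right, real_inner_self_eq_norm_sq, hx]
    field_simp; ring)
  have h : frameAdjoint L y = z := by
    rw [← frameAdjoint_apply_self (L := L) z, hz, map_sub, map_smul, hL.frameAdjoint_eq_zero,
      smul_zero, sub_zero]
  rw [h, hz, add_sub_cancel]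

theorem inner_eq_add_inner_frameAdjoint (hr : 0 < r) (hx : ‖x‖ = r) (y w : E) :
    inner ℝ y w = inner ℝ x y * inner ℝ x w / r ^ 2 +
      inner ℝ (frameAdjoint L y) (frameAdjoint L w) := by
  conv_lhs => rw [← hL.smul_add_frameAdjoint hr hx w]
  rw [inner_add_right, inner_smul_right, inner_frameAdjoint_left, real_inner_comm x y]
  ring

theorem frameAdjoint_hemisphereParam (z : EuclideanSpace ℝ (Fin d)) :
    frameAdjoint L (hemisphereParam r x L z) = z := by
  rw [hemisphereParam, map_add, map_smul, hL.frameAdjoint_eq_zero, smul_zero, zero_add,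
    frameAdjoint_apply_self]

omit [CompleteSpace E] in
theorem inner_hemisphereParam (hx : ‖x‖ = r) (z : EuclideanSpace ℝ (Fin d)) :
    inner ℝ x (hemisphereParam r x L z) = √(r ^ 2 - ‖z‖ ^ 2) * r := by
  rw [hemisphereParam, inner_add_right, inner_smul_right, hL.inner_eq_zero,
    real_inner_self_eq_norm_sq, hx]
  rcases eq_or_ne r 0 with rfl | hr
  · simp
  · field_simp; ring

theorem norm_hemisphereParam (hr : 0 < r) (hx : ‖x‖ = r) {z : EuclideanSpace ℝ (Fin d)}
    (hz : ‖z‖ < r) : ‖hemisphereParam r x L z‖ = r := by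
  refine (pow_left_inj₀ (norm_nonneg _) hr.le two_ne_zero).1 ?_
  have h : 0 ≤ r ^ 2 - ‖z‖ ^ 2 := by nlinarith [norm_nonneg z]
  rw [← real_inner_self_eq_norm_sq, hL.inner_eq_add_inner_frameAdjoint hr hx,
    hL.inner_hemisphereParam hx, hL.frameAdjoint_hemisphereParam, real_inner_self_eq_norm_sq]
  have := Real.sq_sqrt h
  field_simp
  nlinarith

theorem norm_frameAdjoint_lt (hr : 0 < r) (hx : ‖x‖ = r) {y : E} (hy : ‖y‖ = r)
    (hxy : 0 < inner ℝ x y) : ‖frameAdjoint L y‖ < r := by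
  have h := hL.inner_eq_add_inner_frameAdjoint hr hx y y
  rw [real_inner_self_eq_norm_sq, real_inner_self_eq_norm_sq, hy] at h
  have : 0 < inner ℝ x y * inner ℝ x y / r ^ 2 := by positivity
  exact lt_of_pow_lt_pow_left₀ 2 hr.le (by linarith)

theorem hemisphereParam_frameAdjoint (hr : 0 < r) (hx : ‖x‖ = r) {y : E} (hy : ‖y‖ = r)
    (hxy : 0 < inner ℝ x y) : hemisphereParam r x L (frameAdjoint L y) = y := by
  have h := hL.inner_eq_add_inner_frameAdjoint hr hx y y
  rw [real_inner_self_eq_norm_sq, real_inner_self_eq_norm_sq, hy] at h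
  have h2 : r ^ 2 - ‖frameAdjoint L y‖ ^ 2 = (inner ℝ x y / r) ^ 2 := by
    rw [div_pow, pow_two (inner ℝ x y)]; linarith
  conv_rhs => rw [← hL.smul_add_frameAdjoint hr hx y]
  rw [hemisphereParam, h2, Real.sqrt_sq (by positivity), div_div, ← pow_two]

end IsOrthogonalFrame

theorem contDiffAt_height (hr : 0 < r) {z : EuclideanSpace ℝ (Fin d)} (hz : ‖z‖ < r) :
    ContDiffAt ℝ ∞ (fun z : EuclideanSpace ℝ (Fin d) => √(r ^ 2 - ‖z‖ ^ 2) / r) z := by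
  refine ContDiffAt.div_const (ContDiffAt.sqrt ?_ ?_) r
  · exact contDiffAt_const.sub (contDiff_norm_sq ℝ).contDiffAt
  · nlinarith [norm_nonneg z]

omit [CompleteSpace E] in
theorem contDiffAt_hemisphereParam (hr : 0 < r) {z : EuclideanSpace ℝ (Fin d)} (hz : ‖z‖ < r) :
    ContDiffAt ℝ ∞ (hemisphereParam r x L) z :=
  ((contDiffAt_height hr hz).smul contDiffAt_const).add L.contDiff.contDiffAt

omit [CompleteSpace E] in
theorem continuous_hemisphereParam : Continuous (hemisphereParam r x L) := by
  unfold hemisphereParam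
  have := L.continuous
  fun_prop

theorem IsOrthogonalFrame.isLocalParametrization (hL : IsOrthogonalFrame x L) (hr : 0 < r)
    (hx : ‖x‖ = r) {Ω : Set E} (hΩ : IsOpen Ω) :
    IsLocalParametrization (Metric.sphere 0 r ∩ Ω)
      (Metric.ball 0 r ∩ hemisphereParam r x L ⁻¹' Ω) (hemisphereParam r x L) where
  isOpen := Metric.isOpen_ball.inter (hΩ.preimage continuous_hemisphereParam)
  contDiffOn z hz :=
    (contDiffAt_hemisphereParam hr (mem_ball_zero_iff.1 hz.1)).contDiffWithinAt
  immersion z hz := by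
    have h1 := ((contDiffAt_hemisphereParam (x := x) (L := L) hr
      (mem_ball_zero_iff.1 hz.1)).differentiableAt (by simp)).hasFDerivAt
    have h2 := (frameAdjoint L).hasFDerivAt.comp z h1
    have h3 : frameAdjoint L ∘ hemisphereParam r x L = id :=
      funext hL.frameAdjoint_hemisphereParam
    rw [h3] at h2
    have h4 := h2.unique (hasFDerivAt_id z)
    exact Function.LeftInverse.injective (g := frameAdjoint L) fun w => congrArg (fun A => A w) h4
  injOn := Function.LeftInverse.injective (g := frameAdjoint L)
    hL.frameAdjoint_hemisphereParam |>.injOn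
  isOpenMap W hWV hW := by
    -- The condition `0 < ⟨x, y⟩` discards the opposite hemisphere, which has the same projection.
    refine ⟨frameAdjoint L ⁻¹' W ∩ {y | 0 < inner ℝ x y},
      (hW.preimage (frameAdjoint L).continuous).inter
        (isOpen_lt continuous_const (continuous_const.inner continuous_id)), ?_⟩
    ext y
    constructor
    · rintro ⟨z, hz, rfl⟩
      have hz' := mem_ball_zero_iff.1 (hWV hz).1
      refine ⟨⟨by simpa using hL.norm_hemisphereParam hr hx hz', (hWV hz).2⟩, ?_, ?_⟩
      · simpa [hL.frameAdjoint_hemisphereParam] using hz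
      · change 0 < inner ℝ x _
        rw [hL.inner_hemisphereParam hx]
        have : 0 < r ^ 2 - ‖z‖ ^ 2 := by nlinarith [norm_nonneg z]
        positivity
    · rintro ⟨⟨hy, -⟩, hyW, hxy⟩
      exact ⟨_, hyW, hL.hemisphereParam_frameAdjoint hr hx (mem_sphere_zero_iff_norm.1 hy) hxy⟩

omit [CompleteSpace E] in
theorem partialDeriv_hemisphereParam (hr : 0 < r) {z : EuclideanSpace ℝ (Fin d)} (hz : ‖z‖ < r)
    (i : Fin d) : partialDeriv i (hemisphereParam r x L) z =
      partialDeriv i (fun z => √(r ^ 2 - ‖z‖ ^ 2) / r) z • x + L (EuclideanSpace.single i 1) := by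
  have h1 := ((contDiffAt_height hr hz).differentiableAt (by simp)).hasFDerivAt
  have h2 := (h1.smul_const x).add L.toContinuousLinearMap.hasFDerivAt
  have h3 : fderiv ℝ (hemisphereParam r x L) z = _ := h2.fderiv
  simp [partialDeriv, h3]

theorem fderiv_height_zero (hr : 0 < r) :
    fderiv ℝ (fun z : EuclideanSpace ℝ (Fin d) => √(r ^ 2 - ‖z‖ ^ 2) / r) 0 = 0 := by
  refine IsLocalMax.fderiv_eq_zero (Eventually.of_forall fun z => ?_)
  simp only [norm_zero]
  gcongr
  exact norm_nonneg z

omit [CompleteSpace E] in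
theorem IsOrthogonalFrame.metricCoeff_hemisphereParam (hL : IsOrthogonalFrame x L) (hr : 0 < r)
    (hx : ‖x‖ = r) (α : E → ℝ) {z : EuclideanSpace ℝ (Fin d)} (hz : ‖z‖ < r) (i j : Fin d) :
    metricCoeff (conditionMetric α) (hemisphereParam r x L) z i j =
      α (hemisphereParam r x L z) *
        (partialDeriv i (fun z => √(r ^ 2 - ‖z‖ ^ 2) / r) z *
          partialDeriv j (fun z => √(r ^ 2 - ‖z‖ ^ 2) / r) z * r ^ 2 +
            (1 : Matrix (Fin d) (Fin d) ℝ) i j) := by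
  simp only [metricCoeff, conditionMetric, Matrix.of_apply, partialDeriv_hemisphereParam hr hz]
  rw [inner_add_left, inner_add_right, inner_add_right, inner_smul_left, inner_smul_left,
    inner_smul_right, inner_smul_right, hL.inner_eq_zero, hL.inner_left_eq_zero,
    real_inner_self_eq_norm_sq, hx, L.inner_map_map, EuclideanSpace.inner_single_left]
  simp only [Matrix.one_apply, conj_trivial, PiLp.single_apply, mul_zero, add_zero, zero_add]
  ring

omit [CompleteSpace E] in
theorem hasFDerivAt_hemisphereParam_zero (hr : 0 < r) :
    HasFDerivAt (hemisphereParam r x L) L.toContinuousLinearMap 0 := by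
  have h1 := ((contDiffAt_height (d := d) hr (z := 0) (by simpa)).differentiableAt
    (by simp)).hasFDerivAt
  rw [fderiv_height_zero hr] at h1
  have h2 := (h1.smul_const x).add L.toContinuousLinearMap.hasFDerivAt
  rw [ContinuousLinearMap.zero_smulRight, zero_add] at h2
  exact h2

omit [CompleteSpace E] in
theorem hemisphereParam_zero (hr : 0 < r) : hemisphereParam r x L 0 = x := by
  simp [hemisphereParam, Real.sqrt_sq hr.le, hr.ne']

omit [CompleteSpace E] in
theorem IsOrthogonalFrame.metricCoeff_hemisphereParam_zero (hL : IsOrthogonalFrame x L)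
    (hr : 0 < r) (hx : ‖x‖ = r) (α : E → ℝ) :
    metricCoeff (conditionMetric α) (hemisphereParam r x L) 0 = α x • 1 := by
  ext i j
  rw [hL.metricCoeff_hemisphereParam hr hx α (by simpa)]
  simp [partialDeriv, fderiv_height_zero hr, hemisphereParam_zero hr]

omit [CompleteSpace E] in
-- The height has a critical point at the pole, so the products of its partial derivatives vanish
-- there to second order and only the derivative of `α` survives.
theorem IsOrthogonalFrame.partialDeriv_metricCoeff_hemisphereParam_zero
    (hL : IsOrthogonalFrame x L) (hr : 0 < r) (hx : ‖x‖ = r) {α : E → ℝ} {α' : E →L[ℝ] ℝ}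
    (hα : HasFDerivAt α α' x) (l i j : Fin d) :
    partialDeriv l (fun z => metricCoeff (conditionMetric α) (hemisphereParam r x L) z i j) 0 =
      if i = j then α' (L (EuclideanSpace.single l 1)) else 0 := by
  let u : EuclideanSpace ℝ (Fin d) → ℝ := fun z => √(r ^ 2 - ‖z‖ ^ 2) / r
  have hu : ContDiffAt ℝ ∞ u 0 := contDiffAt_height hr (by simpa)
  have hb (i : Fin d) : DifferentiableAt ℝ (fun z => partialDeriv i u z) 0 := by
    have h := (hu.fderiv_right (m := ∞) (by simp)).differentiableAt (by simp)
    exact h.clm_apply (differentiableAt_const _)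
  have hb0 (i : Fin d) : partialDeriv i u 0 = 0 := by
    simp [partialDeriv, u, fderiv_height_zero hr]
  have hφ : HasFDerivAt (fun z => α (hemisphereParam r x L z)) (α' ∘L L.toContinuousLinearMap) 0 := by
    refine HasFDerivAt.comp (0 : EuclideanSpace ℝ (Fin d)) ?_ (hasFDerivAt_hemisphereParam_zero hr)
    rwa [hemisphereParam_zero hr]
  have h1 := hφ.mul (((((hb i).hasFDerivAt.mul (hb j).hasFDerivAt)).mul_const (r ^ 2)).add_const
    ((1 : Matrix (Fin d) (Fin d) ℝ) i j))
  have hev : (fun z => metricCoeff (conditionMetric α) (hemisphereParam r x L) z i j) =ᶠ[𝓝 0] _ :=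
    (eventually_of_mem (Metric.ball_mem_nhds 0 hr) fun z hz =>
      hL.metricCoeff_hemisphereParam hr hx α (mem_ball_zero_iff.1 hz) i j)
  have h2 := (h1.congr_of_eventuallyEq hev).fderiv
  rw [partialDeriv, h2]
  split_ifs with h <;> simp [hb0, Matrix.one_apply, h]

omit [CompleteSpace E] in
theorem IsOrthogonalFrame.christoffel_contraction (hL : IsOrthogonalFrame x L)
    (hr : 0 < r) (hx : ‖x‖ = r) {α : E → ℝ} {α' : E →L[ℝ] ℝ} (hα : HasFDerivAt α α' x)
    (v : EuclideanSpace ℝ (Fin d)) (k : Fin d) :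
    ∑ i, ∑ j, christoffel (metricCoeff (conditionMetric α) (hemisphereParam r x L)) 0 k i j
      * v i * v j =
      (α x)⁻¹ * (α' (L v) * v k - α' (L (EuclideanSpace.single k 1)) * ‖v‖ ^ 2 / 2) := by
  rw [christoffel_contraction_of_conformal (hL.metricCoeff_hemisphereParam_zero hr hx α) _
    (fun l i j => hL.partialDeriv_metricCoeff_hemisphereParam_zero hr hx hα l i j) v k]
  have h1 : α' (L v) = ∑ i, α' (L (EuclideanSpace.single i 1)) * v i := by
    conv_lhs => rw [← (EuclideanSpace.basisFun (Fin d) ℝ).sum_repr v]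
    simp [mul_comm]
  rw [h1, EuclideanSpace.norm_sq_eq]
  simp

end Sphere

/-! ### Second-order comparison along geodesics and self-convexity. -/

section SelfConvex

open Module Filter Topology

/-- A negative second derivative would make `t` a local maximum too, hence `f` locally constant and
the second derivative zero. -/
theorem IsLocalMin.deriv_deriv_nonneg {f : ℝ → ℝ} {t : ℝ} (h : IsLocalMin f t)
    (hf : ContinuousAt f t) : 0 ≤ deriv (deriv f) t := by
  by_contra! hneg
  have hmax := isLocalMax_of_deriv_deriv_neg hneg h.deriv_eq_zero hf
  have hconst : f =ᶠ[𝓝 t] fun _ => f t := by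
    filter_upwards [h, hmax] with s h1 h2 using le_antisymm h2 h1
  have := hconst.deriv.deriv_eq
  simp at this
  linarith

theorem ContDiffAt.hasDerivAt_deriv {F : Type*} [NormedAddCommGroup F] [NormedSpace ℝ F]
    {f : ℝ → F} {t : ℝ} (hf : ContDiffAt ℝ 2 f t) :
    (∀ᶠ s in 𝓝 t, HasDerivAt f (deriv f s) s) ∧ HasDerivAt (deriv f) (deriv (deriv f) t) t := by
  constructor
  · filter_upwards [hf.eventually (by simp)] with s hs
    exact (hs.differentiableAt (by simp)).hasDerivAt
  · have h := (hf.fderiv_right (m := 1) (by norm_num)).differentiableAt (by simp)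
    exact (h.clm_apply (differentiableAt_const 1)).hasDerivAt

theorem deriv_deriv_eq_of_eventually_hasDerivAt {F : Type*} [NormedAddCommGroup F] [NormedSpace ℝ F]
    {f f' : ℝ → F} {f'' : F} {t : ℝ} (h : ∀ᶠ s in 𝓝 t, HasDerivAt f (f' s) s)
    (h' : HasDerivAt f' f'' t) : deriv (deriv f) t = f'' := by
  have : deriv f =ᶠ[𝓝 t] f' := h.mono fun s hs => hs.deriv
  rw [this.deriv_eq, h'.deriv]

/-- If `ψ ≤ p` near `t` with equality at `t`, then `ψ` and `p` have the same derivative at `t` and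
`ψ'' t ≤ p'' t`. -/
theorem deriv_eq_and_deriv_deriv_le {ψ p : ℝ → ℝ} {t : ℝ} (hψ : ContDiffAt ℝ 2 ψ t)
    (hp : ContDiffAt ℝ 2 p t) (hle : ∀ᶠ s in 𝓝 t, ψ s ≤ p s) (heq : ψ t = p t) :
    deriv ψ t = deriv p t ∧ deriv (deriv ψ) t ≤ deriv (deriv p) t := by
  have hmin : IsLocalMin (p - ψ) t := by
    filter_upwards [hle] with s hs
    simpa [heq] using hs
  obtain ⟨h1, h1'⟩ := hψ.hasDerivAt_deriv
  obtain ⟨h2, h2'⟩ := hp.hasDerivAt_deriv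
  have h3 : ∀ᶠ s in 𝓝 t, HasDerivAt (p - ψ) ((deriv p - deriv ψ) s) s := by
    filter_upwards [h1, h2] with s hs1 hs2 using hs2.sub hs1
  have h4 := deriv_deriv_eq_of_eventually_hasDerivAt h3 (h2'.sub h1')
  have h5 := hmin.deriv_deriv_nonneg (hp.sub hψ).continuousAt
  have h6 := hmin.deriv_eq_zero
  rw [h3.self_of_nhds.deriv, Pi.sub_apply] at h6
  constructor <;> linarith

variable {E : Type*} [NormedAddCommGroup E] [InnerProductSpace ℝ E]

theorem hasDerivAt_norm_sq_and_deriv {P : E →L[ℝ] E} {γ : ℝ → E} {t : ℝ}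
    (hγ : ContDiffAt ℝ 2 γ t) :
    deriv (fun s => ‖P (γ s)‖ ^ 2) t = 2 * inner ℝ (P (γ t)) (P (deriv γ t)) ∧
    deriv (deriv fun s => ‖P (γ s)‖ ^ 2) t =
      2 * (‖P (deriv γ t)‖ ^ 2 + inner ℝ (P (γ t)) (P (deriv (deriv γ) t))) := by
  obtain ⟨h1, h2⟩ := hγ.hasDerivAt_deriv
  have h3 : ∀ᶠ s in 𝓝 t, HasDerivAt (fun s => ‖P (γ s)‖ ^ 2)
      (2 * inner ℝ (P (γ s)) (P (deriv γ s))) s := by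
    filter_upwards [h1] with s hs using (P.hasFDerivAt.comp_hasDerivAt s hs).norm_sq
  refine ⟨h3.self_of_nhds.deriv, deriv_deriv_eq_of_eventually_hasDerivAt h3 ?_⟩
  have h4 := (P.hasFDerivAt.comp_hasDerivAt t h1.self_of_nhds).inner ℝ
    (P.hasFDerivAt.comp_hasDerivAt t h2)
  have h5 := h4.const_mul 2
  rw [Function.comp_apply, Function.comp_apply, real_inner_self_eq_norm_sq, add_comm] at h5
  exact h5

/-- The second derivative is `(ψ'² - ψ'' ψ) / ψ²`. -/
theorem deriv_deriv_log_inv_nonneg {ψ : ℝ → ℝ} {t : ℝ} (hψ : ContDiffAt ℝ 2 ψ t) (h0 : 0 < ψ t)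
    (h : deriv (deriv ψ) t * ψ t ≤ deriv ψ t ^ 2) :
    0 ≤ deriv (deriv fun s => Real.log (ψ s)⁻¹) t := by
  obtain ⟨h1, h2⟩ := hψ.hasDerivAt_deriv
  have h3 : ∀ᶠ s in 𝓝 t, HasDerivAt (fun s => Real.log (ψ s)⁻¹) (-(deriv ψ s / ψ s)) s := by
    filter_upwards [h1, hψ.continuousAt.eventually_ne h0.ne'] with s hs hs0
    simpa only [Real.log_inv] using (hs.log hs0).fun_neg
  rw [deriv_deriv_eq_of_eventually_hasDerivAt h3 (h2.div h1.self_of_nhds h0.ne').fun_neg, ← neg_div]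
  refine div_nonneg ?_ (by positivity)
  linarith [pow_two (deriv ψ t)]

variable [FiniteDimensional ℝ E]

/-- The geodesic equation of a conformal metric on a sphere at a point `γ t`, tested against the
tangential component of a vector. -/
theorem IsGeodesicOn.inner_deriv_deriv {r : ℝ} (hr : 0 < r) {Ω : Set E} (hΩ : IsOpen Ω)
    {α : E → ℝ} {I : Set ℝ} {γ : ℝ → E}
    (hγ : IsGeodesicOn (conditionMetric α) (Metric.sphere 0 r ∩ Ω) γ I) {t : ℝ}
    (ht : t ∈ interior I) {g : E} {β : ℝ} (hα : HasFDerivAt α (β • innerSL ℝ g) (γ t)) (N : E) :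
    inner ℝ N (deriv (deriv γ) t) = -(inner ℝ (γ t) N * ‖deriv γ t‖ ^ 2 / r ^ 2) -
      (α (γ t))⁻¹ * β * (inner ℝ g (deriv γ t) * inner ℝ N (deriv γ t) -
        (inner ℝ g N - inner ℝ (γ t) g * inner ℝ (γ t) N / r ^ 2) * ‖deriv γ t‖ ^ 2 / 2) := by
  obtain ⟨hC, hM, hgeo⟩ := hγ
  have hI : I ∈ 𝓝 t := mem_interior_iff_mem_nhds.1 ht
  have hγt : ContDiffAt ℝ 2 γ t := hC.contDiffAt hI
  obtain ⟨h1, h2⟩ := hγt.hasDerivAt_deriv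
  have hx : ‖γ t‖ = r := mem_sphere_zero_iff_norm.1 (hM (interior_subset ht)).1
  have hx0 : γ t ≠ 0 := norm_pos_iff.1 (hx ▸ hr)
  -- Differentiating `‖γ‖² = r²` twice gives `⟨γ, γ'⟩ = 0` and `⟨γ, γ''⟩ = -‖γ'‖²`, the normal part
  -- of the acceleration; the chart centred at `γ t` gives the tangential part.
  have hnorm : (fun s => ‖ContinuousLinearMap.id ℝ E (γ s)‖ ^ 2) =ᶠ[𝓝 t] fun _ => r ^ 2 := by
    filter_upwards [hI] with s hs
    rw [ContinuousLinearMap.id_apply, mem_sphere_zero_iff_norm.1 (hM hs).1]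
  obtain ⟨hd1, hd2⟩ := hasDerivAt_norm_sq_and_deriv (P := .id ℝ E) hγt
  rw [hnorm.deriv_eq, deriv_const] at hd1
  rw [hnorm.deriv.deriv_eq] at hd2
  simp only [deriv_const', ContinuousLinearMap.id_apply] at hd1 hd2
  obtain ⟨d, hd⟩ : ∃ d, finrank ℝ E = d + 1 := by
    have : Nontrivial E := ⟨γ t, 0, hx0⟩
    exact ⟨finrank ℝ E - 1, (Nat.sub_add_cancel finrank_pos).symm⟩
  obtain ⟨L, hL⟩ := exists_isOrthogonalFrame hd hx0
  let A := frameAdjoint L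
  have hA0 : A (γ t) = 0 := hL.frameAdjoint_eq_zero
  let J := interior I ∩ γ ⁻¹' {y | 0 < inner ℝ (γ t) y}
  have hJ : IsOpen J := (hC.continuousOn.mono interior_subset).isOpen_inter_preimage
    isOpen_interior (isOpen_lt continuous_const (continuous_const.inner continuous_id))
  have hJI : J ⊆ I := fun s hs => interior_subset hs.1
  have htJ : t ∈ J := ⟨ht, by
    change 0 < inner ℝ (γ t) (γ t)
    rw [real_inner_self_eq_norm_sq, hx]; positivity⟩
  have hφ : Set.EqOn (hemisphereParam r (γ t) L ∘ fun s => A (γ s)) γ J := fun s hs =>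
    hL.hemisphereParam_frameAdjoint hr hx (mem_sphere_zero_iff_norm.1 (hM (hJI hs)).1) hs.2
  have key := hgeo d _ _ (hL.isLocalParametrization hr hx hΩ) J (fun s => A (γ s)) hJ hJI
    (A.contDiff.comp_contDiffOn (hC.mono hJI))
    (fun s hs => ⟨mem_ball_zero_iff.2 (hL.norm_frameAdjoint_lt hr hx
      (mem_sphere_zero_iff_norm.1 (hM (hJI hs)).1) hs.2), by
        rw [Set.mem_preimage, show hemisphereParam r (γ t) L (A (γ s)) = γ s from hφ hs]
        exact (hM (hJI hs)).2⟩)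
    hφ t htJ
  set v := deriv γ t
  set w := deriv (deriv γ) t
  let e (k : Fin d) : E →L[ℝ] ℝ := (EuclideanSpace.proj k).comp A
  have hc1 (k : Fin d) : ∀ᶠ s in 𝓝 t, HasDerivAt (fun s => A (γ s) k) (e k (deriv γ s)) s := by
    filter_upwards [h1] with s hs using (e k).hasFDerivAt.comp_hasDerivAt s hs
  have hc2 (k : Fin d) : deriv (deriv fun s => A (γ s) k) t = A w k :=
    deriv_deriv_eq_of_eventually_hasDerivAt (hc1 k) ((e k).hasFDerivAt.comp_hasDerivAt t h2)
  have hc1' (k : Fin d) : deriv (fun s => A (γ s) k) t = A v k := (hc1 k).self_of_nhds.deriv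
  simp only [hc2, hc1', hA0, hL.christoffel_contraction hr hx hα] at key
  have hvx : inner ℝ (γ t) v = 0 := by linarith
  have hLv : L (A v) = v := by
    have := hL.smul_add_frameAdjoint hr hx v
    rwa [hvx, zero_div, zero_smul, zero_add] at this
  have hAv : ‖A v‖ = ‖v‖ := by rw [← L.norm_map, hLv]
  have hsum : inner ℝ (A N) (A w) = -((α (γ t))⁻¹ * β * (inner ℝ g v * inner ℝ (A N) (A v) -
      inner ℝ (A g) (A N) * ‖v‖ ^ 2 / 2)) := by
    have hcoord (k : Fin d) : A w k = -((α (γ t))⁻¹ * β * (inner ℝ g v * A v k -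
        A g k * ‖v‖ ^ 2 / 2)) := by
      have h := key k
      have h' : inner ℝ g (L (EuclideanSpace.single k 1)) = A g k := by
        rw [← inner_frameAdjoint_left]
        simp [A, EuclideanSpace.inner_single_right]
      simp only [FunLike.coe_smul, Pi.smul_apply, innerSL_apply_apply, smul_eq_mul, hLv, hAv, h'] at h
      linarith
    have hw : A w = -((α (γ t))⁻¹ * β) • (inner ℝ g v • A v - (‖v‖ ^ 2 / 2) • A g) := by
      ext k
      simp only [PiLp.smul_apply, PiLp.sub_apply, smul_eq_mul, hcoord]
      ring
    rw [hw, inner_smul_right, inner_sub_right, inner_smul_right, inner_smul_right,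
      real_inner_comm (A g)]
    ring
  have hNv := hL.inner_eq_add_inner_frameAdjoint hr hx N v
  have hNw := hL.inner_eq_add_inner_frameAdjoint hr hx N w
  have hgN := hL.inner_eq_add_inner_frameAdjoint hr hx g N
  have hxw : inner ℝ (γ t) w = -‖v‖ ^ 2 := by linarith
  rw [hvx, mul_zero, zero_div, zero_add] at hNv
  change inner ℝ N v = inner ℝ (A N) (A v) at hNv
  change _ = _ + inner ℝ (A N) (A w) at hNw
  change _ = _ + inner ℝ (A g) (A N) at hgN
  rw [hNw, hsum, hxw, hNv, hgN]
  ring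

/-- If on the open set `Ω` the function `ρ` is at every point touched from above by the norm of an
orthogonal projection, then `ρ⁻²` is self-convex on the part of any centred sphere in `Ω`. -/
theorem isSelfConvexOn_sphere_inter {Ω : Set E} (hΩ : IsOpen Ω) {ρ : E → ℝ}
    (hpos : ∀ x ∈ Ω, 0 < ρ x) (hρ : ContDiffOn ℝ 2 (fun x => ρ x ^ 2) Ω)
    (hP : ∀ x ∈ Ω, ∃ P : E →ₗ[ℝ] E, P.IsSymmetricProjection ∧ (∀ y ∈ Ω, ρ y ≤ ‖P y‖) ∧
      ρ x = ‖P x‖) {r : ℝ} (hr : 0 < r) :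
    IsSelfConvexOn (Metric.sphere 0 r ∩ Ω) fun x => (ρ x ^ 2)⁻¹ where
  isEmbeddedSubmanifold := by
    refine ⟨finrank ℝ E - 1, fun x hx => ?_⟩
    have hxr : ‖x‖ = r := mem_sphere_zero_iff_norm.1 hx.1
    have hx0 : x ≠ 0 := norm_pos_iff.1 (hxr ▸ hr)
    have : Nontrivial E := ⟨x, 0, hx0⟩
    obtain ⟨L, hL⟩ := exists_isOrthogonalFrame (Nat.sub_add_cancel finrank_pos).symm hx0
    refine ⟨_, _, hL.isLocalParametrization hr hxr hΩ, 0, ⟨by simpa, ?_⟩, hemisphereParam_zero hr⟩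
    rw [Set.mem_preimage, hemisphereParam_zero hr]
    exact hx.2
  pos x hx := by
    have := hpos x hx.2
    positivity
  contDiffOn d V φ hφ := by
    -- Taking the whole of `V` as the open set shows that `φ` maps `V` into the manifold.
    obtain ⟨U, -, hU⟩ := hφ.isOpenMap V subset_rfl hφ.isOpen
    have hmaps : Set.MapsTo φ V Ω := fun z hz =>
      (hU ▸ Set.mem_image_of_mem φ hz : φ z ∈ Metric.sphere 0 r ∩ Ω ∩ U).1.2
    have h : ContDiffOn ℝ 2 (fun x => (ρ x ^ 2)⁻¹) Ω :=
      hρ.inv fun x hx => (pow_pos (hpos x hx) 2).ne'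
    exact h.comp (hφ.contDiffOn.of_le (ENat.LEInfty.out)) hmaps
  convex I γ hI hγ := by
    have hM : Set.MapsTo γ I Ω := fun s hs => (hγ.2.1 hs).2
    have hψI : ContDiffOn ℝ 2 (fun s => ρ (γ s) ^ 2) I := hρ.comp hγ.1 hM
    have hpos' (s : ℝ) (hs : s ∈ I) : 0 < ρ (γ s) ^ 2 := pow_pos (hpos _ (hM hs)) 2
    have hlog : ContDiffOn ℝ 2 (fun s => Real.log (ρ (γ s) ^ 2)⁻¹) I :=
      (hψI.inv fun s hs => (hpos' s hs).ne').log fun s hs => (inv_pos.2 (hpos' s hs)).ne'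
    have hat (s : ℝ) (hs : s ∈ interior I) := hlog.contDiffAt (mem_interior_iff_mem_nhds.1 hs)
    refine convexOn_of_deriv2_nonneg hI.convex hlog.continuousOn
      (fun s hs => ((hat s hs).differentiableAt (by simp)).differentiableWithinAt)
      (fun s hs => (hat s hs).hasDerivAt_deriv.2.differentiableAt.differentiableWithinAt)
      fun t ht => ?_
    have htI : I ∈ 𝓝 t := mem_interior_iff_mem_nhds.1 ht
    have hxΩ : γ t ∈ Ω := hM (interior_subset ht)
    obtain ⟨P₀, hPP, hPle, hPx⟩ := hP _ hxΩ
    let P : E →L[ℝ] E := LinearMap.toContinuousLinearMap P₀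
    have hψ : ContDiffAt ℝ 2 (fun s => ρ (γ s) ^ 2) t := hψI.contDiffAt htI
    have hγt : ContDiffAt ℝ 2 γ t := hγ.1.contDiffAt htI
    have hsymm (y z : E) : inner ℝ (P y) z = inner ℝ y (P z) := hPP.isSymmetric y z
    have hidem (y : E) : P (P y) = P y := LinearMap.congr_fun hPP.isIdempotentElem y
    have hnormP (y : E) : inner ℝ y (P y) = ‖P y‖ ^ 2 := by
      rw [← real_inner_self_eq_norm_sq, hsymm, hidem]
    have hPsq (y : E) : ‖P y‖ ^ 2 ≤ ‖y‖ ^ 2 := by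
      have h1 := real_inner_le_norm y (P y)
      rw [hnormP] at h1
      nlinarith [norm_nonneg y, norm_nonneg (P y), sq_nonneg (‖y‖ - ‖P y‖)]
    set x := γ t
    set v := deriv γ t
    -- `‖P y‖² - ρ y²` has a local minimum at `x`, so the differentials agree; that of `‖P y‖²` is
    -- `2⟨P x, ·⟩` since `P` is symmetric and idempotent.
    have hgrad : HasFDerivAt (fun y => ρ y ^ 2) ((2 : ℝ) • innerSL ℝ (P x)) x := by
      have h1 : HasFDerivAt (fun y => ρ y ^ 2) _ x :=
        ((hρ.contDiffAt (hΩ.mem_nhds hxΩ)).differentiableAt (by simp)).hasFDerivAt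
      have h2 : HasFDerivAt (fun y => ‖P y‖ ^ 2) _ x := P.hasFDerivAt.norm_sq
      have hmin : IsLocalMin (fun y => ‖P y‖ ^ 2 - ρ y ^ 2) x := by
        filter_upwards [hΩ.mem_nhds hxΩ] with y hy
        have h3 : ρ x ^ 2 = ‖P x‖ ^ 2 := congrArg (· ^ 2) hPx
        have h4 : ρ y ^ 2 ≤ ‖P y‖ ^ 2 := pow_le_pow_left₀ (hpos y hy).le (hPle y hy) 2
        linarith
      have h3 := hmin.hasFDerivAt_eq_zero (h2.fun_sub h1)
      have h4 : (2 : ℝ) • innerSL ℝ (P x) = fderiv ℝ (fun y => ρ y ^ 2) x := by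
        rw [← sub_eq_zero.1 h3]
        ext y
        simp [← hsymm, hidem, two_smul]
      rwa [h4]
    have hgrad' : HasFDerivAt (fun y => (ρ y ^ 2)⁻¹)
        ((-((ρ x ^ 2) ^ 2)⁻¹ * 2) • innerSL ℝ (P x)) x := by
      have h := (hasDerivAt_inv (hpos' t (interior_subset ht)).ne').comp_hasFDerivAt x hgrad
      rwa [smul_smul] at h
    -- Testing against the gradient direction `P x` is enough, as `γ''` enters the second derivative
    -- of `‖P γ‖²` only through `⟨P x, γ''⟩`.
    have hgeo := hγ.inner_deriv_deriv hr hΩ ht hgrad' (P x)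
    have hp : ContDiffAt ℝ 2 (fun s => ‖P (γ s)‖ ^ 2) t :=
      (P.contDiff.contDiffAt.comp t hγt).norm_sq ℝ
    obtain ⟨hcomp1, hcomp2⟩ := deriv_eq_and_deriv_deriv_le hψ hp
      (by
        filter_upwards [htI] with s hs
        exact pow_le_pow_left₀ (hpos _ (hM hs)).le (hPle _ (hM hs)) 2)
      (congrArg (· ^ 2) hPx)
    obtain ⟨hp1, hp2⟩ := hasDerivAt_norm_sq_and_deriv (P := P) hγt
    refine deriv_deriv_log_inv_nonneg hψ (hpos' t (interior_subset ht)) ?_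
    rw [hcomp1, hp1]
    refine (mul_le_mul_of_nonneg_right hcomp2 (hpos' t (interior_subset ht)).le).trans ?_
    have hρx : ‖P x‖ ^ 2 = ρ x ^ 2 := congrArg (· ^ 2) hPx.symm
    have hgg : inner ℝ (P x) (P x) = ρ x ^ 2 := by rw [real_inner_self_eq_norm_sq, hρx]
    have hxg : inner ℝ x (P x) = ρ x ^ 2 := by rw [hnormP, hρx]
    have hPP' (y : E) : inner ℝ (P x) (P y) = inner ℝ (P x) y := by rw [← hsymm, hidem]
    rw [hp2, hPP', hPP', hgeo, hgg, hxg]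
    change 2 * (‖P v‖ ^ 2 + _) * ρ x ^ 2 ≤ _
    have hq := hpos' t (interior_subset ht)
    change 0 < ρ x ^ 2 at hq
    generalize ρ x ^ 2 = q at *
    generalize inner ℝ (P x) v = a at *
    have h1 := hPsq v
    -- With `w = γ''`, `⟨P x, w⟩ = 2a²/q - ‖v‖²`, so what remains is `2q(‖P v‖² - ‖v‖²) ≤ 0`.
    field_simp
    nlinarith [mul_le_mul_of_nonneg_left h1 hq.le]

end SelfConvex

theorem mainTheorem7 {𝕜 : Type*} [RCLike 𝕜] (n m : ℕ) (hn : 1 ≤ n) (hnm : n ≤ m)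
    (r : ℝ) (hr : 0 < r) :
    IsSelfConvexOn (Metric.sphere (0 : Matrix (Fin n) (Fin m) 𝕜) r ∩ GLgt 𝕜 n m)
      (fun A => (sigma n A ^ 2)⁻¹) := by
  refine isSelfConvexOn_sphere_inter (isOpen_GLgt hn)
    (fun A hA => (sigma_pos_iff_rank_eq hn A).2 hA.1)
    (fun A hA => ((contDiffAt_sq_sigma hn hnm hA).of_le ENat.LEInfty.out).contDiffWithinAt)
    (fun A hA => ?_) hr
  obtain ⟨P, hP, hle, hA⟩ := exists_isSymmetricProjection_sigma hn hA
  exact ⟨P, hP, fun B _ => hle B, hA⟩
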